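/- For a field $K$, let $\mathrm{Conf}^n(K)$ be the set of $n$-tuples $q=(q_1,\dots,q_n)\in K^n$ of pairwise distinct points. For $q\in\mathrm{Conf}^n(K)$ and $d\ge 0$, let $\mathrm{End}_d(q)$ be the set of polynomials $f\in K[x]$ of degree exactly $d$ (the zero polynomial being given degree $0$) such that $f(\{q_1,\dots,q_n\})\subseteq\{q_1,\dots,q_n\}$. Call $q,r\in\mathrm{Conf}^n(K)$ affinely equivalent if there are $a\in K\setminus\{0\}$ and $b\in K$ such that $x\mapsto ax+b$ maps the set $\{q_1,\dots,q_n\}$ onto the set $\{r_1,\dots,r_n\}$ (so the order in which the points are listed is disregarded). Then the maximum $E_{4,2}$ of $|\mathrm{End}_2(q)|$ over $q\in\mathrm{Conf}^4(\mathbb{C})$ exists and equals $28$. It is attained by exactly one affine equivalence class: for $q\in\mathrm{Conf}^4(\mathbb{C})$ one has $|\mathrm{End}_2(q)|=28$ if and only if $q$ is affinely equivalent to the configuration $\mu_4=(1,i,-1,-i)$ of fourth roots of unity. -/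

import Mathlib

open Polynomial

/-- The configuration space `Conf^n(K)` of ordered `n`-tuples of pairwise distinct points on the
affine line over `K`. -/
abbrev Conf (n : ℕ) (K : Type*) := Fin n ↪ K

namespace Conf

variable {n : ℕ} {K : Type*} [Field K]

/-- `End(q)`: the polynomials `f` over `K` which map the set of points of `q` into itself. -/
def polyEnd (q : Conf n K) : Set K[X] :=
  {f | Set.MapsTo (fun x => f.eval x) (Set.range q) (Set.range q)}

/-- `End_d(q)`: the elements of `End(q)` of degree exactly `d`, where the zero polynomial is
considered to have degree `0`. -/
def polyEndDeg (d : ℕ) (q : Conf n K) : Set K[X] :=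
  {f | f ∈ q.polyEnd ∧ f.natDegree = d}

/-- Affine equivalence of configurations, regardless of the order in which the points are listed:
some invertible affine map `x ↦ a * x + b` carries the points of `q` to the points of `r`. -/
def AffinelyEquivalent (q r : Conf n K) : Prop :=
  ∃ a b : K, a ≠ 0 ∧ ∃ σ : Equiv.Perm (Fin n), ∀ i, a * q i + b = r (σ i)

theorem affinelyEquivalent_equivalence :
    Equivalence (AffinelyEquivalent : Conf n K → Conf n K → Prop) where
  refl q := ⟨1, 0, one_ne_zero, 1, fun i => by simp⟩
  symm := by
    rintro q r ⟨a, b, ha, σ, h⟩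
    refine ⟨a⁻¹, -(a⁻¹ * b), inv_ne_zero ha, σ⁻¹, fun i => ?_⟩
    have h1 : a * q (σ⁻¹ i) + b = r i := by simpa using h (σ⁻¹ i)
    rw [← h1]
    field_simp
    ring
  trans := by
    rintro q r s ⟨a, b, ha, σ, h⟩ ⟨a', b', ha', τ, h'⟩
    refine ⟨a' * a, a' * b + b', mul_ne_zero ha' ha, τ * σ, fun i => ?_⟩
    rw [Equiv.Perm.mul_apply, ← h', ← h]
    ring

/-- The configuration `μ₄ = (1, i, -1, -i)` of fourth roots of unity. -/
def mu4 : Conf 4 ℂ where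
  toFun := ![1, Complex.I, -1, -Complex.I]
  inj' := by
    intro j k h
    fin_cases j <;> fin_cases k <;> simp [Complex.ext_iff] at h ⊢ <;> norm_num at h

end Conf

/-! A polynomial of degree at most 3 is determined by its values on `q`, so quadratic endomorphisms
are self-maps of the four points killed by one linear form (`weight`), minus those induced by affine
maps (`encard_polyEndDeg_two`). By AM-GM the form has at most as many zeros as the additive energy
of `q`.

Without parallelograms and with at most one arithmetic progression the energy is at most 32; the
four constants and the identity are affine, leaving 27. Two progressions force the class of 0, 1, 2,
4, which is counted directly.

A parallelogram is equivalent to 1, -1, t, -t, where the zeros are the solutions of `q c - q d = t *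
(q a - q b)`. There are at most 33 unless `t ^ 2 = -1`, and central symmetry is a sixth affine map,
again leaving 27. The case `t ^ 2 = -1` is `mu4`, with 28. -/

theorem card_coincidences_eq_sum {α β γ : Type*} [Fintype α] [Fintype β] [DecidableEq γ]
    (f : α → γ) (g : β → γ) {I : Finset γ} (hf : ∀ a, f a ∈ I) :
    (Finset.univ.filter fun p : α × β => f p.1 = g p.2).card =
      ∑ s ∈ I, (Finset.univ.filter fun a => f a = s).card *
        (Finset.univ.filter fun b => g b = s).card := by
  rw [Finset.card_eq_sum_card_fiberwise (f := fun p : α × β => f p.1) (t := I)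
    (fun p _ => hf p.1)]
  refine Finset.sum_congr rfl fun s _ => ?_
  rw [← Finset.card_product]
  congr 1
  ext ⟨a, b⟩
  simp only [Finset.mem_filter, Finset.mem_univ, true_and, Finset.mem_product]
  constructor
  · rintro ⟨h1, h2⟩
    exact ⟨h2, h1 ▸ h2⟩
  · rintro ⟨h1, h2⟩
    exact ⟨h1.trans h2.symm, h1⟩

/-- If `f` and `g` have finite domains, twice the number of coincidences `f a = g b` is at most the
number of coincidences of `f` with itself plus that of `g` with itself. -/
theorem two_mul_card_coincidences_le {α β γ : Type*} [Fintype α] [Fintype β] [DecidableEq γ]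
    (f : α → γ) (g : β → γ) :
    2 * (Finset.univ.filter fun p : α × β => f p.1 = g p.2).card ≤
      (Finset.univ.filter fun p : α × α => f p.1 = f p.2).card +
        (Finset.univ.filter fun p : β × β => g p.1 = g p.2).card := by
  set I : Finset γ := Finset.univ.image f ∪ Finset.univ.image g with hI
  have hf : ∀ a, f a ∈ I := fun a => by simp [hI]
  have hg : ∀ a, g a ∈ I := fun a => by simp [hI]
  rw [card_coincidences_eq_sum f g hf, card_coincidences_eq_sum f f hf,
    card_coincidences_eq_sum g g hg, Finset.mul_sum, ← Finset.sum_add_distrib]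
  refine Finset.sum_le_sum fun s _ => ?_
  have := two_mul_le_add_sq (Finset.univ.filter fun a => f a = s).card
    (Finset.univ.filter fun b => g b = s).card
  nlinarith

/-! ### Additive energy and zeros of linear forms -/

namespace Conf

/-- The number of solutions of `q x - q y = q z - q w`. -/
noncomputable def additiveEnergy {n : ℕ} (q : Conf n ℂ) : ℕ :=
  (Finset.univ.filter fun p : (Fin n × Fin n) × (Fin n × Fin n) =>
    q p.1.1 - q p.1.2 = q p.2.1 - q p.2.2).card

/-- The number of zeros of a linear form in four variables, all of whose coefficients are nonzero,
on the points of `q` is at most the additive energy of `q`. -/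
theorem card_linear_form_le_additiveEnergy {n : ℕ} (q : Conf n ℂ) (c : Fin 4 → ℂ)
    (hc : ∀ i, c i ≠ 0) :
    (Finset.univ.filter fun p : (Fin n × Fin n) × (Fin n × Fin n) =>
      c 0 * q p.1.1 + c 1 * q p.1.2 + c 2 * q p.2.1 + c 3 * q p.2.2 = 0).card ≤
        q.additiveEnergy := by
  -- Scaling the differences does not change how often they coincide.
  have self : ∀ c : ℂ, c ≠ 0 →
      (Finset.univ.filter fun p : (Fin n × Fin n) × (Fin n × Fin n) =>
        c * (q p.1.1 - q p.1.2) = c * (q p.2.1 - q p.2.2)).card = q.additiveEnergy := by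
    intro c hc
    simp only [mul_right_inj' hc, additiveEnergy]
  have pair : ∀ c d : ℂ, c ≠ 0 → d ≠ 0 →
      (Finset.univ.filter fun p : (Fin n × Fin n) × (Fin n × Fin n) =>
        c * q p.1.1 + d * q p.1.2 = c * q p.2.1 + d * q p.2.2).card ≤ q.additiveEnergy := by
    intro c d hc hd
    -- The equation regroups as `c * (q a - q a') = d * (q b' - q b)`, a coincidence between two
    -- scaled difference maps.
    have h := two_mul_card_coincidences_le (fun p : Fin n × Fin n => c * (q p.1 - q p.2))
      (fun p : Fin n × Fin n => d * (q p.1 - q p.2))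
    rw [self c hc, self d hd] at h
    refine le_trans (le_of_eq ?_) (Nat.le_of_mul_le_mul_left (h.trans (by omega)) two_pos)
    refine Finset.card_bij' (fun p _ => ((p.1.1, p.2.1), (p.2.2, p.1.2)))
      (fun p _ => ((p.1.1, p.2.2), (p.1.2, p.2.1))) ?_ ?_ ?_ ?_
    · rintro ⟨⟨a, b⟩, ⟨a', b'⟩⟩ h
      simp only [Finset.mem_filter, Finset.mem_univ, true_and] at h ⊢
      linear_combination h
    · rintro ⟨⟨a, b⟩, ⟨a', b'⟩⟩ h
      simp only [Finset.mem_filter, Finset.mem_univ, true_and] at h ⊢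
      linear_combination h
    · simp
    · simp
  have h := two_mul_card_coincidences_le
    (fun p : Fin n × Fin n => c 0 * q p.1 + c 1 * q p.2)
    (fun p : Fin n × Fin n => -c 2 * q p.1 + -c 3 * q p.2)
  have h1 := pair (c 0) (c 1) (hc 0) (hc 1)
  have h2 := pair (-c 2) (-c 3) (neg_ne_zero.2 (hc 2)) (neg_ne_zero.2 (hc 3))
  refine le_trans (le_of_eq ?_) (Nat.le_of_mul_le_mul_left (h.trans (by omega)) two_pos)
  congr 1
  refine Finset.filter_congr fun p _ => ?_
  constructor <;> intro h <;> linear_combination h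

/-! ### Quadratic endomorphisms as zeros of a linear form -/

/-- The affine dependence between the values of a polynomial of degree at most two at the points
of `q`, with coefficients normalized to be Vandermonde determinants. -/
def weight (q : Conf 4 ℂ) : Fin 4 → ℂ :=
  ![-((q 1 - q 2) * (q 1 - q 3) * (q 2 - q 3)), (q 0 - q 2) * (q 0 - q 3) * (q 2 - q 3),
    -((q 0 - q 1) * (q 0 - q 3) * (q 1 - q 3)), (q 0 - q 1) * (q 0 - q 2) * (q 1 - q 2)]

theorem sub_ne_zero_of_ne (q : Conf 4 ℂ) {i j : Fin 4} (h : i ≠ j) : q i - q j ≠ 0 :=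
  sub_ne_zero.2 fun e => h (q.injective e)

theorem weight_ne_zero (q : Conf 4 ℂ) (i : Fin 4) : q.weight i ≠ 0 := by
  fin_cases i <;>
  simp [weight, sub_eq_zero]

/-- The tuples `p` for which the values `q (p i)` satisfy the dependence `weight q`. -/
noncomputable def weightZeros (q : Conf 4 ℂ) :
    Finset ((Fin 4 × Fin 4) × (Fin 4 × Fin 4)) :=
  Finset.univ.filter fun p => q.weight 0 * q p.1.1 + q.weight 1 * q p.1.2 +
    q.weight 2 * q p.2.1 + q.weight 3 * q p.2.2 = 0

/-- The tuples `p` such that `q i ↦ q (p i)` is interpolated by a polynomial of degree two. -/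
noncomputable def quadraticTuples (q : Conf 4 ℂ) :
    Finset ((Fin 4 × Fin 4) × (Fin 4 × Fin 4)) :=
  q.weightZeros.filter fun p =>
    (q p.2.1 - q p.1.1) * (q 1 - q 0) ≠ (q p.1.2 - q p.1.1) * (q 2 - q 0)

/-- The weighted sum is the cubic coefficient times a nonzero Vandermonde determinant; once it
vanishes, the difference of the two sides of the inequality is the quadratic coefficient times
another one, up to sign. -/
theorem natDegree_eq_two_iff (q : Conf 4 ℂ) {f : ℂ[X]} (hf : f.degree < 4) :
    f.natDegree = 2 ↔
      q.weight 0 * f.eval (q 0) + q.weight 1 * f.eval (q 1) + q.weight 2 * f.eval (q 2) +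
        q.weight 3 * f.eval (q 3) = 0 ∧
      (f.eval (q 2) - f.eval (q 0)) * (q 1 - q 0) ≠
        (f.eval (q 1) - f.eval (q 0)) * (q 2 - q 0) := by
  have hlt : f.natDegree < 4 := by
    by_cases h0 : f = 0
    · simp [h0]
    · exact (natDegree_lt_iff_degree_lt h0).2 hf
  have hev : ∀ x, f.eval x =
      f.coeff 0 + f.coeff 1 * x + f.coeff 2 * x ^ 2 + f.coeff 3 * x ^ 3 := fun x => by
    rw [eval_eq_sum_range' hlt]
    simp [Finset.sum_range_succ]
  have h01 := q.sub_ne_zero_of_ne (show (0 : Fin 4) ≠ 1 by decide)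
  have h02 := q.sub_ne_zero_of_ne (show (0 : Fin 4) ≠ 2 by decide)
  have h03 := q.sub_ne_zero_of_ne (show (0 : Fin 4) ≠ 3 by decide)
  have h12 := q.sub_ne_zero_of_ne (show (1 : Fin 4) ≠ 2 by decide)
  have h13 := q.sub_ne_zero_of_ne (show (1 : Fin 4) ≠ 3 by decide)
  have h23 := q.sub_ne_zero_of_ne (show (2 : Fin 4) ≠ 3 by decide)
  have h3 : q.weight 0 * f.eval (q 0) + q.weight 1 * f.eval (q 1) + q.weight 2 * f.eval (q 2) +
        q.weight 3 * f.eval (q 3) = -f.coeff 3 * ((q 0 - q 1) * (q 0 - q 2) * (q 0 - q 3) *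
          (q 1 - q 2) * (q 1 - q 3) * (q 2 - q 3)) := by
    simp only [hev, weight, Matrix.cons_val]
    ring
  have h2 : f.coeff 3 = 0 → (f.eval (q 2) - f.eval (q 0)) * (q 1 - q 0) -
        (f.eval (q 1) - f.eval (q 0)) * (q 2 - q 0) =
          -f.coeff 2 * ((q 0 - q 1) * (q 0 - q 2) * (q 1 - q 2)) := by
    intro h
    simp only [hev, h]
    ring
  have hV : (q 0 - q 1) * (q 0 - q 2) * (q 0 - q 3) * (q 1 - q 2) * (q 1 - q 3) * (q 2 - q 3) ≠ 0 :=
    by simp only [ne_eq, mul_eq_zero]; tauto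
  have hV' : (q 0 - q 1) * (q 0 - q 2) * (q 1 - q 2) ≠ 0 := by
    simp only [ne_eq, mul_eq_zero]; tauto
  rw [h3, mul_eq_zero, or_iff_left hV, neg_eq_zero]
  constructor
  · intro h
    have hc : f.coeff 3 = 0 := coeff_eq_zero_of_natDegree_lt (by omega)
    refine ⟨hc, ?_⟩
    rw [← sub_ne_zero, h2 hc]
    refine mul_ne_zero (neg_ne_zero.2 ?_) hV'
    rw [← h]
    exact leadingCoeff_ne_zero.2 (by rintro rfl; simp at h)
  · rintro ⟨hc, h⟩
    rw [← sub_ne_zero, h2 hc] at h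
    have hc2 : f.coeff 2 ≠ 0 := by
      intro h0
      simp [h0] at h
    have := le_natDegree_of_ne_zero hc2
    by_contra hne
    have h3 : f.natDegree = 3 := by omega
    have : f.leadingCoeff = 0 := by rw [leadingCoeff, h3, hc]
    rw [leadingCoeff_eq_zero] at this
    simp [this] at h3

theorem encard_polyEndDeg_two (q : Conf 4 ℂ) :
    (q.polyEndDeg 2).encard = (q.quadraticTuples.card : ℕ∞) := by
  have hinj : Set.InjOn q (Finset.univ : Finset (Fin 4)) := q.injective.injOn
  set P : (Fin 4 × Fin 4) × (Fin 4 × Fin 4) → ℂ[X] := fun p =>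
    Lagrange.interpolate Finset.univ q ![q p.1.1, q p.1.2, q p.2.1, q p.2.2] with hP
  have hdeg : ∀ p, (P p).degree < 4 := fun p =>
    (Lagrange.degree_interpolate_lt _ hinj).trans_eq (by simp)
  have hev : ∀ p i, (P p).eval (q i) = ![q p.1.1, q p.1.2, q p.2.1, q p.2.2] i := fun p i =>
    Lagrange.eval_interpolate_at_node _ hinj (Finset.mem_univ i)
  have hmem : ∀ p, p ∈ q.quadraticTuples ↔ (P p).natDegree = 2 := fun p => by
    rw [natDegree_eq_two_iff q (hdeg p)]
    simp only [hev, Matrix.cons_val, quadraticTuples, weightZeros, Finset.mem_filter,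
      Finset.mem_univ, true_and]
  have himage : q.polyEndDeg 2 = P '' q.quadraticTuples := by
    ext f
    simp only [Set.mem_image, Finset.mem_coe, hmem]
    constructor
    · rintro ⟨hf, hd⟩
      have hx : ∀ i, ∃ j, q j = f.eval (q i) := fun i => hf ⟨i, rfl⟩
      choose φ hφ using hx
      have he : P ((φ 0, φ 1), (φ 2, φ 3)) = f := by
        refine (Lagrange.eq_interpolate_of_eval_eq _ hinj ?_ fun i _ => ?_).symm
        · refine lt_of_le_of_lt degree_le_natDegree ?_
          rw [hd]
          exact_mod_cast (by norm_num : 2 < 4)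
        · rw [← hφ]
          fin_cases i <;> rfl
      exact ⟨_, he ▸ hd, he⟩
    · rintro ⟨p, hp, rfl⟩
      refine ⟨?_, hp⟩
      rintro _ ⟨i, rfl⟩
      change (P p).eval (q i) ∈ _
      rw [hev]
      fin_cases i <;> exact ⟨_, rfl⟩
  have hPinj : Function.Injective P := by
    intro p p' h
    have h' : ∀ i, ![q p.1.1, q p.1.2, q p.2.1, q p.2.2] i =
        ![q p'.1.1, q p'.1.2, q p'.2.1, q p'.2.2] i := fun i => by rw [← hev, ← hev, h]
    have h0 := q.injective (h' 0)
    have h1 := q.injective (h' 1)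
    have h2 := q.injective (h' 2)
    have h3 := q.injective (h' 3)
    exact Prod.ext (Prod.ext h0 h1) (Prod.ext h2 h3)
  rw [himage, hPinj.encard_image, Set.encard_coe_eq_coe_finsetCard]

theorem weight_sum (q : Conf 4 ℂ) :
    q.weight 0 + q.weight 1 + q.weight 2 + q.weight 3 = 0 := by
  simp only [weight, Matrix.cons_val]
  ring

theorem weight_sum_mul (q : Conf 4 ℂ) :
    q.weight 0 * q 0 + q.weight 1 * q 1 + q.weight 2 * q 2 + q.weight 3 * q 3 = 0 := by
  simp only [weight, Matrix.cons_val]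
  ring

/-- Tuples which come from affine maps may be removed from `weightZeros`. -/
theorem card_quadraticTuples_add_le (q : Conf 4 ℂ)
    (A : Finset ((Fin 4 × Fin 4) × (Fin 4 × Fin 4)))
    (hA : ∀ p ∈ A, ∃ a b : ℂ, q p.1.1 = a * q 0 + b ∧ q p.1.2 = a * q 1 + b ∧
      q p.2.1 = a * q 2 + b ∧ q p.2.2 = a * q 3 + b) :
    q.quadraticTuples.card + A.card ≤ q.weightZeros.card := by
  have hd : Disjoint q.quadraticTuples A := by
    rw [Finset.disjoint_left]
    intro p hp hpA
    obtain ⟨a, b, h0, h1, h2, h3⟩ := hA p hpA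
    refine (Finset.mem_filter.1 hp).2 ?_
    rw [h0, h1, h2]
    ring
  rw [← Finset.card_union_of_disjoint hd]
  refine Finset.card_le_card (Finset.union_subset (Finset.filter_subset _ _) fun p hpA => ?_)
  obtain ⟨a, b, h0, h1, h2, h3⟩ := hA p hpA
  simp only [weightZeros, Finset.mem_filter, Finset.mem_univ, true_and]
  rw [h0, h1, h2, h3]
  linear_combination a * q.weight_sum_mul + b * q.weight_sum

theorem card_quadraticTuples_add_five_le (q : Conf 4 ℂ) :
    q.quadraticTuples.card + 5 ≤ q.weightZeros.card := by
  refine q.card_quadraticTuples_add_le {((0, 0), (0, 0)), ((1, 1), (1, 1)), ((2, 2), (2, 2)),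
    ((3, 3), (3, 3)), ((0, 1), (2, 3))} fun p hp => ?_
  simp only [Finset.mem_insert, Finset.mem_singleton] at hp
  rcases hp with rfl | rfl | rfl | rfl | rfl
  · exact ⟨0, q 0, by simp⟩
  · exact ⟨0, q 1, by simp⟩
  · exact ⟨0, q 2, by simp⟩
  · exact ⟨0, q 3, by simp⟩
  · exact ⟨1, 0, by simp⟩

theorem card_weightZeros_le (q : Conf 4 ℂ) : q.weightZeros.card ≤ q.additiveEnergy :=
  q.card_linear_form_le_additiveEnergy q.weight q.weight_ne_zero

/-! ### Affine invariance -/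

/-- Affinely equivalent configurations have the same number of endomorphisms of each degree. -/
theorem AffinelyEquivalent.encard_le {n d : ℕ} {q r : Conf n ℂ} (h : q.AffinelyEquivalent r) :
    (q.polyEndDeg d).encard ≤ (r.polyEndDeg d).encard := by
  obtain ⟨a, b, ha, σ, h⟩ := h
  set L : ℂ[X] := C a * X + C b with hL
  set M : ℂ[X] := C a⁻¹ * X + C (-(a⁻¹ * b)) with hM
  have hLd : L.natDegree = 1 := natDegree_linear ha
  have hMd : M.natDegree = 1 := natDegree_linear (inv_ne_zero ha)
  have hLM : L.comp M = X := by
    simp only [hL, hM, add_comp, mul_comp, C_comp, X_comp]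
    have : a * -(a⁻¹ * b) + b = 0 := by field_simp; ring
    rw [mul_add, ← mul_assoc, ← C_mul, ← C_mul, mul_inv_cancel₀ ha, add_assoc, ← C_add, this, C_1,
      one_mul, C_0, add_zero]
  have hML : M.comp L = X := by
    simp only [hL, hM, add_comp, mul_comp, C_comp, X_comp]
    rw [mul_add, ← mul_assoc, ← C_mul, ← C_mul, inv_mul_cancel₀ ha, add_assoc, ← C_add]
    simp
  have hLq : ∀ i, L.eval (q i) = r (σ i) := fun i => by simp [hL, h]
  have hMr : ∀ i, M.eval (r (σ i)) = q i := fun i => by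
    rw [← hLq, ← eval_comp, hML, eval_X]
  -- Conjugation by the affine map `L`, with inverse `M`, carries endomorphisms of `q` to those of
  -- `r` and keeps the degree.
  have hinj : Set.InjOn (fun f : ℂ[X] => (L.comp f).comp M) (q.polyEndDeg d) := by
    intro f _ g _ hfg
    have := congrArg (fun k : ℂ[X] => (M.comp k).comp L) hfg
    simpa [comp_assoc, ← comp_assoc M L, hML] using this
  rw [← hinj.encard_image]
  refine Set.encard_le_encard ?_
  rintro _ ⟨f, ⟨hf, hd⟩, rfl⟩
  refine ⟨?_, by simp [natDegree_comp, hLd, hMd, hd]⟩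
  rintro _ ⟨j, rfl⟩
  obtain ⟨i, rfl⟩ := σ.surjective j
  obtain ⟨k, hk⟩ := hf ⟨i, rfl⟩
  refine ⟨σ k, ?_⟩
  simp only at hk
  simp only [eval_comp]
  rw [hMr, ← hk, hLq]

theorem AffinelyEquivalent.encard_eq {n d : ℕ} {q r : Conf n ℂ} (h : q.AffinelyEquivalent r) :
    (q.polyEndDeg d).encard = (r.polyEndDeg d).encard :=
  le_antisymm h.encard_le (affinelyEquivalent_equivalence.symm h).encard_le

/-- The configuration obtained by listing the points of `q` in another order. -/
def reindex {n : ℕ} (q : Conf n ℂ) (f : Fin n → Fin n) (hf : f.Injective) : Conf n ℂ :=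
  ⟨fun i => q (f i), q.injective.comp hf⟩

theorem affinelyEquivalent_of_image {n : ℕ} {q r : Conf n ℂ} (f : Fin n → Fin n)
    (hf : f.Injective) {a b : ℂ} (ha : a ≠ 0) (h : ∀ i, a * q (f i) + b = r i) :
    q.AffinelyEquivalent r := by
  refine ⟨a, b, ha, (Equiv.ofBijective f (Finite.injective_iff_bijective.1 hf)).symm, fun i => ?_⟩
  rw [← h]
  congr
  exact (Equiv.ofBijective_apply_symm_apply f _ i).symm

theorem affinelyEquivalent_reindex {n : ℕ} (q : Conf n ℂ) (f : Fin n → Fin n) (hf : f.Injective) :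
    q.AffinelyEquivalent (q.reindex f hf) :=
  affinelyEquivalent_of_image f hf one_ne_zero (b := 0) fun i => by simp [reindex]

/-! ### Configurations that are not parallelograms -/

/-- The four points of `q` are the vertices of a possibly degenerate parallelogram. -/
def IsParallelogram (q : Conf 4 ℂ) : Prop :=
  ∃ f : Fin 4 → Fin 4, f.Injective ∧ q (f 0) + q (f 1) = q (f 2) + q (f 3)

/-- Without parallelograms and with at most one arithmetic progression the additive energy is
at most `32`. -/
theorem additiveEnergy_le (q : Conf 4 ℂ) (hq : ¬ q.IsParallelogram)
    (hm : ∀ x y z, y ≠ z → 2 * q x = q y + q z → x = 1 ∧ (y = 0 ∧ z = 2 ∨ y = 2 ∧ z = 0)) :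
    q.additiveEnergy ≤ 32 := by
  have hinj : ∀ x w y z : Fin 4, (x ≠ w ∧ x ≠ y ∧ x ≠ z ∧ w ≠ y ∧ w ≠ z ∧ y ≠ z) →
      Function.Injective ![x, w, y, z] := by decide
  -- There are 16 + 16 - 4 trivial solutions, and four ways to write `2 * q 1 = q 0 + q 2` as an
  -- equality of differences.
  have hcard : (Finset.univ.filter fun p : (Fin 4 × Fin 4) × (Fin 4 × Fin 4) =>
      p.1.1 = p.1.2 ∧ p.2.1 = p.2.2 ∨ p.1.1 = p.2.1 ∧ p.1.2 = p.2.2 ∨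
      p = ((1, 0), (2, 1)) ∨ p = ((1, 2), (0, 1)) ∨ p = ((0, 1), (1, 2)) ∨
        p = ((2, 1), (1, 0))).card = 32 := by decide +kernel
  rw [← hcard]
  refine Finset.card_le_card fun p hp => ?_
  obtain ⟨⟨x, y⟩, ⟨z, w⟩⟩ := p
  simp only [Finset.mem_filter, Finset.mem_univ, true_and] at hp ⊢
  by_cases hxy : x = y
  · subst hxy
    exact Or.inl ⟨rfl, q.injective (by linear_combination -hp)⟩
  by_cases hxz : x = z
  · subst hxz
    exact Or.inr (Or.inl ⟨rfl, q.injective (by linear_combination -hp)⟩)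
  by_cases hwy : w = y
  · subst hwy
    exact absurd (q.injective (by linear_combination hp)) hxz
  by_cases hwz : w = z
  · subst hwz
    exact absurd (q.injective (by linear_combination hp)) hxy
  by_cases hxw : x = w
  · subst hxw
    have hyz : y ≠ z := by
      rintro rfl
      exact hxy (q.injective (by linear_combination hp / 2))
    obtain ⟨rfl, ⟨rfl, rfl⟩ | ⟨rfl, rfl⟩⟩ := hm x y z hyz (by linear_combination hp) <;> simp
  by_cases hyz : y = z
  · subst hyz
    obtain ⟨rfl, ⟨rfl, rfl⟩ | ⟨rfl, rfl⟩⟩ := hm y x w hxw (by linear_combination -hp) <;> simp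
  exact absurd ⟨![x, w, y, z], hinj x w y z ⟨hxw, hxy, hxz, hwy, hwz, hyz⟩,
    by simp only [Matrix.cons_val]; linear_combination hp⟩ hq

/-- If `q` is not a parallelogram but contains an arithmetic progression, then either this is the
only progression or `q` is affinely equivalent to `0, 1, 2, 4`. -/
theorem progression_unique_or (q : Conf 4 ℂ) (hq : ¬ q.IsParallelogram)
    (h : 2 * q 1 = q 0 + q 2) :
    (∀ x y z, y ≠ z → 2 * q x = q y + q z → x = 1 ∧ (y = 0 ∧ z = 2 ∨ y = 2 ∧ z = 0)) ∨
      ∃ f : Fin 4 → Fin 4, f.Injective ∧ 2 * q (f 1) = q (f 0) + q (f 2) ∧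
        2 * q (f 2) = q (f 0) + q (f 3) := by
  by_contra! hcon
  obtain ⟨⟨x, y, z, hyz, hx, hne⟩, hf⟩ := hcon
  have n01 : q 0 ≠ q 1 := q.injective.ne (by decide)
  have n02 : q 0 ≠ q 2 := q.injective.ne (by decide)
  have n03 : q 0 ≠ q 3 := q.injective.ne (by decide)
  have n12 : q 1 ≠ q 2 := q.injective.ne (by decide)
  have n13 : q 1 ≠ q 3 := q.injective.ne (by decide)
  have n23 : q 2 ≠ q 3 := q.injective.ne (by decide)
  -- In a second progression `q 3` either prolongs the first by one step (a parallelogram, `p1` and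
  -- `p2`), or halves a step (`f1`, `f2`), or doubles the progression (`f3`, `f4`).
  have p1 : q 0 + q 1 ≠ q 2 + q 3 := fun e => hq ⟨![0, 1, 2, 3], by decide, e⟩
  have p2 : q 0 + q 3 ≠ q 1 + q 2 := fun e => hq ⟨![0, 3, 1, 2], by decide, e⟩
  have f1 := hf ![0, 3, 1, 2] (by decide)
  have f2 := hf ![2, 3, 1, 0] (by decide)
  have f3 := hf ![2, 1, 0, 3] (by decide)
  have f4 := hf ![0, 1, 2, 3] (by decide)
  simp only [Matrix.cons_val] at f1 f2 f3 f4
  clear hf hq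
  fin_cases x <;> fin_cases y <;> fin_cases z <;>
    simp only [Fin.zero_eta, Fin.mk_one, Fin.reduceFinMk, ne_eq, not_true_eq_false] at hx hyz <;>
    first
    | exact absurd hyz id
    | exact n01 (by linear_combination hx)
    | grind

/-- The configuration `0, 1, 2, 4`. -/
def progressionPair : Conf 4 ℂ where
  toFun := ![0, 1, 2, 4]
  inj' := by
    intro j k h
    fin_cases j <;> fin_cases k <;> simp at h ⊢

theorem progressionPair_apply (i : Fin 4) : progressionPair i = ![0, 1, 2, 4] i := rfl

/-- The additive energy here is 36, too weak a bound, so the zeros are counted over the integers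
with the weights 6, -16, 12, -2. -/
theorem card_weightZeros_progressionPair : progressionPair.weightZeros.card ≤ 32 := by
  set z : Fin 4 → ℤ := ![0, 1, 2, 4] with hz
  have hqz : ∀ i, progressionPair i = z i := fun i => by
    fin_cases i <;> simp [hz, progressionPair_apply]
  have hcard : (Finset.univ.filter fun p : (Fin 4 × Fin 4) × (Fin 4 × Fin 4) =>
      6 * ![(0 : ℤ), 1, 2, 4] p.1.1 - 16 * ![(0 : ℤ), 1, 2, 4] p.1.2 +
        12 * ![(0 : ℤ), 1, 2, 4] p.2.1 - 2 * ![(0 : ℤ), 1, 2, 4] p.2.2 = 0).card ≤ 32 := by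
    decide +kernel
  refine le_trans (Finset.card_le_card fun p hp => ?_) hcard
  simp only [weightZeros, Finset.mem_filter, Finset.mem_univ, true_and, hqz, weight,
    Matrix.cons_val] at hp ⊢
  rw [← hz]
  simp only [hz, Matrix.cons_val] at hp
  rw [← hz] at hp
  have : ((6 * z p.1.1 - 16 * z p.1.2 + 12 * z p.2.1 - 2 * z p.2.2 : ℤ) : ℂ) = 0 := by
    push_cast at hp ⊢
    linear_combination hp
  exact_mod_cast this

theorem encard_le_of_card_weightZeros_le {q : Conf 4 ℂ} (h : q.weightZeros.card ≤ 32) :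
    (q.polyEndDeg 2).encard ≤ 27 := by
  have := q.card_quadraticTuples_add_five_le
  rw [encard_polyEndDeg_two]
  exact_mod_cast (by omega : q.quadraticTuples.card ≤ 27)

theorem IsParallelogram.of_reindex {q : Conf 4 ℂ} {f : Fin 4 → Fin 4} {hf : f.Injective}
    (h : (q.reindex f hf).IsParallelogram) : q.IsParallelogram := by
  obtain ⟨g, hg, h⟩ := h
  exact ⟨f ∘ g, hf.comp hg, h⟩

theorem encard_le_of_not_isParallelogram (q : Conf 4 ℂ) (hq : ¬ q.IsParallelogram) :
    (q.polyEndDeg 2).encard ≤ 27 := by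
  by_cases h : ∃ x y z, y ≠ z ∧ 2 * q x = q y + q z
  · obtain ⟨x, y, z, hyz, h⟩ := h
    have hxy : x ≠ y := by
      rintro rfl
      exact hyz (q.injective (by linear_combination h))
    have hxz : x ≠ z := by
      rintro rfl
      exact hyz (q.injective (by linear_combination -h))
    have hex : ∀ x y z : Fin 4, x ≠ y → x ≠ z → y ≠ z →
        ∃ w, Function.Injective ![y, x, z, w] := by decide
    obtain ⟨w, hw⟩ := hex x y z hxy hxz hyz
    rw [(q.affinelyEquivalent_reindex _ hw).encard_eq]
    have hr : ¬ (q.reindex _ hw).IsParallelogram := fun hr => hq hr.of_reindex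
    rcases progression_unique_or (q.reindex _ hw) hr h with hm | ⟨f, hf, h1, h2⟩
    · exact encard_le_of_card_weightZeros_le
        ((card_weightZeros_le _).trans (additiveEnergy_le _ hr hm))
    · generalize q.reindex _ hw = r at *
      have hne : r (f 1) - r (f 0) ≠ 0 := r.sub_ne_zero_of_ne (hf.ne (by decide))
      have he : r.AffinelyEquivalent progressionPair := by
        refine affinelyEquivalent_of_image f hf (a := (r (f 1) - r (f 0))⁻¹)
          (b := -((r (f 1) - r (f 0))⁻¹ * r (f 0))) (inv_ne_zero hne) fun i => ?_
        rw [← sub_eq_add_neg, ← mul_sub, inv_mul_eq_iff_eq_mul₀ hne]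
        fin_cases i <;> simp only [progressionPair_apply, Matrix.cons_val,
          Fin.zero_eta, Fin.mk_one, Fin.reduceFinMk]
        · ring
        · ring
        · linear_combination -h1
        · linear_combination -h2 - 2 * h1
      rw [he.encard_eq]
      exact encard_le_of_card_weightZeros_le card_weightZeros_progressionPair
  · push Not at h
    exact encard_le_of_card_weightZeros_le ((card_weightZeros_le _).trans
      (additiveEnergy_le _ hq fun x y z hyz hx => absurd hx (h x y z hyz)))

/-! ### Parallelograms -/

/-- The number of representations of `z` as a difference of two points of `q`. -/
noncomputable def diffCount {n : ℕ} (q : Conf n ℂ) (z : ℂ) : ℕ :=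
  ∑ a, ∑ b, if q a - q b = z then 1 else 0

section Parallelogram

variable {q : Conf 4 ℂ} {t : ℂ}

/-- The diagonals give ±2 and ±2t once each; opposite sides are equal, so each side vector is
counted twice. -/
theorem diffCount_parallelogram (h0 : q 0 = 1) (h1 : q 1 = -1) (h2 : q 2 = t) (h3 : q 3 = -t)
    (z : ℂ) :
    q.diffCount z = (if z = 0 then 4 else 0) +
      ((if z = 2 then 1 else 0) + (if z = -2 then 1 else 0) + (if z = 2 * t then 1 else 0) +
        (if z = -2 * t then 1 else 0)) +
      2 * ((if z = 1 - t then 1 else 0) + (if z = t - 1 then 1 else 0) +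
        (if z = 1 + t then 1 else 0) + (if z = -1 - t then 1 else 0)) := by
  have e : ∀ a b c : ℂ, a - b = c → (if a - b = z then 1 else 0 : ℕ) = if z = c then 1 else 0 := by
    rintro a b c rfl
    simp only [eq_comm]
  simp only [diffCount, Fin.sum_univ_four, h0, h1, h2, h3]
  rw [e 1 1 0 (by ring), e 1 (-1) 2 (by ring), e 1 t (1 - t) (by ring), e 1 (-t) (1 + t) (by ring),
    e (-1) 1 (-2) (by ring), e (-1) (-1) 0 (by ring), e (-1) t (-1 - t) (by ring),
    e (-1) (-t) (t - 1) (by ring), e t 1 (t - 1) (by ring), e t (-1) (1 + t) (by ring),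
    e t t 0 (by ring), e t (-t) (2 * t) (by ring), e (-t) 1 (-1 - t) (by ring),
    e (-t) (-1) (1 - t) (by ring), e (-t) t (-2 * t) (by ring), e (-t) (-t) 0 (by ring)]
  split_ifs <;> omega

theorem diffCount_neg {n : ℕ} (q : Conf n ℂ) (z : ℂ) : q.diffCount (-z) = q.diffCount z := by
  rw [diffCount, diffCount, Finset.sum_comm]
  refine Finset.sum_congr rfl fun a _ => Finset.sum_congr rfl fun b _ => ?_
  exact if_congr (by rw [← neg_inj, neg_sub, neg_neg]) rfl rfl

/-- The weights are proportional to -t, t, 1, -1, so the zeros are counted by summing `diffCount`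
over the differences scaled by t, grouped up to sign. -/
theorem card_weightZeros_parallelogram (h0 : q 0 = 1) (h1 : q 1 = -1) (h2 : q 2 = t)
    (h3 : q 3 = -t) :
    q.weightZeros.card = 4 * q.diffCount 0 + 2 * q.diffCount (2 * t) +
      2 * q.diffCount (2 * t ^ 2) + 4 * q.diffCount (t - t ^ 2) + 4 * q.diffCount (t + t ^ 2) := by
  have n02 : 1 - t ≠ 0 := by rw [← h0, ← h2]; exact q.sub_ne_zero_of_ne (by decide)
  have n03 : 1 + t ≠ 0 := by
    have := q.sub_ne_zero_of_ne (show (0 : Fin 4) ≠ 3 by decide)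
    rwa [h0, h3, sub_neg_eq_add] at this
  have hiff : ∀ p : (Fin 4 × Fin 4) × (Fin 4 × Fin 4),
      (q.weight 0 * q p.1.1 + q.weight 1 * q p.1.2 + q.weight 2 * q p.2.1 +
        q.weight 3 * q p.2.2 = 0) ↔ q p.2.1 - q p.2.2 = t * (q p.1.1 - q p.1.2) := fun p => by
    have : q.weight 0 * q p.1.1 + q.weight 1 * q p.1.2 + q.weight 2 * q p.2.1 +
        q.weight 3 * q p.2.2 = (2 * (1 - t) * (1 + t)) *
          ((q p.2.1 - q p.2.2) - t * (q p.1.1 - q p.1.2)) := by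
      simp only [weight, Matrix.cons_val, h0, h1, h2, h3]
      ring
    rw [this, mul_eq_zero, or_iff_right (mul_ne_zero (mul_ne_zero two_ne_zero n02) n03),
      sub_eq_zero]
  have hsum : q.weightZeros.card = ∑ a, ∑ b, q.diffCount (t * (q a - q b)) := by
    simp only [weightZeros, hiff, Finset.card_filter, Fintype.sum_prod_type, diffCount]
  rw [hsum]
  simp only [Fin.sum_univ_four, h0, h1, h2, h3]
  have e : ∀ a b : ℂ, (a = b ∨ a = -b) → q.diffCount a = q.diffCount b := by
    rintro a b (rfl | rfl)
    · rfl
    · exact q.diffCount_neg b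
  rw [e (t * (1 - 1)) 0 (by left; ring), e (t * (1 - -1)) (2 * t) (by left; ring),
    e (t * (1 - t)) (t - t ^ 2) (by left; ring), e (t * (1 - -t)) (t + t ^ 2) (by left; ring),
    e (t * (-1 - 1)) (2 * t) (by right; ring), e (t * (-1 - -1)) 0 (by left; ring),
    e (t * (-1 - t)) (t + t ^ 2) (by right; ring), e (t * (-1 - -t)) (t - t ^ 2) (by right; ring),
    e (t * (t - 1)) (t - t ^ 2) (by right; ring), e (t * (t - -1)) (t + t ^ 2) (by left; ring),
    e (t * (t - t)) 0 (by left; ring), e (t * (t - -t)) (2 * t ^ 2) (by left; ring),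
    e (t * (-t - 1)) (t + t ^ 2) (by right; ring), e (t * (-t - -1)) (t - t ^ 2) (by left; ring),
    e (t * (-t - t)) (2 * t ^ 2) (by right; ring), e (t * (-t - -t)) 0 (by left; ring)]
  ring

theorem diffCount_zero {n : ℕ} (q : Conf n ℂ) : q.diffCount 0 = n := by
  simp [diffCount, sub_eq_zero]

theorem card_weightZeros_parallelogram_le (h0 : q 0 = 1) (h1 : q 1 = -1) (h2 : q 2 = t)
    (h3 : q 3 = -t) (ht : t ^ 2 ≠ -1) : q.weightZeros.card ≤ 33 := by
  have n2 : t ≠ 1 := by rw [← h0, ← h2]; exact q.injective.ne (by decide)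
  have n1 : t ≠ -1 := by rw [← h1, ← h2]; exact q.injective.ne (by decide)
  have n0 : t ≠ 0 := fun e =>
    q.injective.ne (show (2 : Fin 4) ≠ 3 by decide) (by rw [h2, h3, e, neg_zero])
  rw [card_weightZeros_parallelogram h0 h1 h2 h3, diffCount_zero]
  have hD := diffCount_parallelogram h0 h1 h2 h3
  suffices q.diffCount (2 * t) + q.diffCount (2 * t ^ 2) + 2 * q.diffCount (t - t ^ 2) +
    2 * q.diffCount (t + t ^ 2) ≤ 8 by omega
  -- At t = ±3 and ±1/3 a diagonal equals a side vector up to sign; elsewhere a nonzero difference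
  -- is represented at most twice, and twice only if it is a side.
  by_cases a1 : t = 3
  · subst a1
    simp only [hD]
    norm_num
  by_cases a2 : t = -3
  · subst a2
    simp only [hD]
    norm_num
  by_cases a3 : t = 1 / 3
  · subst a3
    simp only [hD]
    norm_num
  by_cases a4 : t = -1 / 3
  · subst a4
    simp only [hD]
    norm_num
  have d1 : q.diffCount (2 * t) ≤ 1 := by rw [hD]; grind
  have two : ∀ z, z ≠ 0 → q.diffCount z ≤ 2 := by intro z hz; rw [hD]; grind
  have one : ∀ z, z ≠ 0 → z ≠ 1 - t → z ≠ t - 1 → z ≠ 1 + t → z ≠ -1 - t →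
    q.diffCount z ≤ 1 := by intro z _ _ _ _ _; rw [hD]; grind
  have none : ∀ z, z ≠ 0 → z ≠ 2 → z ≠ -2 → z ≠ 2 * t → z ≠ -2 * t → z ≠ 1 - t → z ≠ t - 1 →
      z ≠ 1 + t → z ≠ -1 - t → q.diffCount z = 0 := by
    intro z h1 h2 h3 h4 h5 h6 h7 h8 h9
    rw [hD]
    simp only [h1, h2, h3, h4, h5, h6, h7, h8, h9, if_false, add_zero, mul_zero]
  clear hD
  have b1 := two (2 * t ^ 2) (by simp [n0])
  have b2 := two (t - t ^ 2) (by grind)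
  have b3 := two (t + t ^ 2) (by grind)
  -- As `t ^ 2 ≠ -1`, `t - t ^ 2` is a side only in case `c1`, and `t + t ^ 2` only in case `c2`; in
  -- each case the other one is not a difference at all.
  by_cases c1 : t ^ 2 = 2 * t + 1
  · have : q.diffCount (t + t ^ 2) = 0 := by
      rw [show t + t ^ 2 = 3 * t + 1 by rw [c1]; ring]
      apply none <;> grind
    omega
  by_cases c2 : t ^ 2 = -2 * t + 1
  · have : q.diffCount (t - t ^ 2) = 0 := by
      rw [show t - t ^ 2 = 3 * t - 1 by rw [c2]; ring]
      apply none <;> grind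
    omega
  have := one (t - t ^ 2) (by grind) (by grind) (by grind) (by grind) (by grind)
  have := one (t + t ^ 2) (by grind) (by grind) (by grind) (by grind) (by grind)
  omega

end Parallelogram

/-! ### The fourth roots of unity and the conclusion -/

theorem mu4_apply (i : Fin 4) : mu4 i = ![1, Complex.I, -1, -Complex.I] i := rfl

theorem card_quadraticTuples_mu4 : mu4.quadraticTuples.card = 28 := by
  set z : Fin 4 → GaussianInt := ![⟨1, 0⟩, ⟨0, 1⟩, ⟨-1, 0⟩, ⟨0, -1⟩] with hz
  have hqz : ∀ i, mu4 i = GaussianInt.toComplex (z i) := fun i => by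
    fin_cases i <;> simp [hz, mu4_apply, GaussianInt.toComplex_def]
  have hcard : (Finset.univ.filter fun p : (Fin 4 × Fin 4) × (Fin 4 × Fin 4) =>
      (z 0 * z p.1.1 + z 1 * z p.1.2 + z 2 * z p.2.1 + z 3 * z p.2.2 = 0) ∧
      (z p.2.1 - z p.1.1) * (z 1 - z 0) ≠ (z p.1.2 - z p.1.1) * (z 2 - z 0)).card = 28 := by
    rw [hz]
    decide +kernel
  -- The weights are proportional to the points themselves, so the count can be decided in the
  -- Gaussian integers.
  have hw : ∀ i, mu4.weight i = 4 * Complex.I * mu4 i := fun i => by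
    have : Complex.I ^ 3 = -Complex.I := Complex.I_pow_three
    have : Complex.I ^ 2 = -1 := Complex.I_sq
    fin_cases i <;> simp [weight, mu4_apply] <;> grind
  rw [← hcard, quadraticTuples, weightZeros, Finset.filter_filter]
  congr 1
  refine Finset.filter_congr fun p _ => and_congr ?_ (not_congr ?_)
  · rw [← GaussianInt.toComplex_inj]
    simp only [map_add, map_mul, ← hqz, hw, map_zero]
    have : 4 * Complex.I ≠ 0 := by simp
    simp only [mul_assoc (4 * Complex.I), ← mul_add]
    exact mul_eq_zero_iff_left this
  · rw [← GaussianInt.toComplex_inj]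
    simp only [map_sub, map_mul, ← hqz]

theorem encard_mu4 : (mu4.polyEndDeg 2).encard = 28 := by
  rw [encard_polyEndDeg_two, card_quadraticTuples_mu4]
  rfl

/-- A parallelogram is affinely equivalent to `1, -1, t, -t` for some `t`. -/
theorem IsParallelogram.exists_affinelyEquivalent {q : Conf 4 ℂ} (hq : q.IsParallelogram) :
    ∃ r : Conf 4 ℂ, q.AffinelyEquivalent r ∧ r 0 = 1 ∧ r 1 = -1 ∧ r 3 = -r 2 := by
  obtain ⟨f, hf, h⟩ := hq
  have hne : q (f 0) - q (f 1) ≠ 0 := q.sub_ne_zero_of_ne (hf.ne (by decide))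
  have ha : 2 / (q (f 0) - q (f 1)) ≠ 0 := div_ne_zero two_ne_zero hne
  -- This affine map sends the centre of the parallelogram to 0 and `q (f 0)` to 1.
  let r : Conf 4 ℂ := ⟨fun i => 2 / (q (f 0) - q (f 1)) * q (f i) +
    -((q (f 0) + q (f 1)) / (q (f 0) - q (f 1))), fun i j hij =>
      hf (q.injective (mul_left_cancel₀ ha (add_right_cancel hij)))⟩
  have hr : ∀ i, r i = 2 / (q (f 0) - q (f 1)) * q (f i) +
    -((q (f 0) + q (f 1)) / (q (f 0) - q (f 1))) := fun i => rfl
  refine ⟨r, affinelyEquivalent_of_image f hf ha fun i => rfl, ?_, ?_, ?_⟩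
  · rw [hr]
    field_simp
    ring
  · rw [hr]
    field_simp
    ring
  · rw [hr, hr]
    field_simp
    linear_combination (-2) * h

theorem encard_parallelogram_le {q : Conf 4 ℂ} (h0 : q 0 = 1) (h1 : q 1 = -1)
    (h3 : q 3 = -q 2) (ht : q 2 ^ 2 ≠ -1) : (q.polyEndDeg 2).encard ≤ 27 := by
  have hle := card_weightZeros_parallelogram_le h0 h1 rfl h3 ht
  have := q.card_quadraticTuples_add_le {((0, 0), (0, 0)), ((1, 1), (1, 1)), ((2, 2), (2, 2)),
    ((3, 3), (3, 3)), ((0, 1), (2, 3)), ((1, 0), (3, 2))} fun p hp => by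
      simp only [Finset.mem_insert, Finset.mem_singleton] at hp
      rcases hp with rfl | rfl | rfl | rfl | rfl | rfl
      · exact ⟨0, q 0, by simp⟩
      · exact ⟨0, q 1, by simp⟩
      · exact ⟨0, q 2, by simp⟩
      · exact ⟨0, q 3, by simp⟩
      · exact ⟨1, 0, by simp⟩
      · exact ⟨-1, 0, by simp [h0, h1, h3]⟩
  have h6 : q.quadraticTuples.card + 6 ≤ q.weightZeros.card := this
  rw [encard_polyEndDeg_two]
  exact_mod_cast (by omega : q.quadraticTuples.card ≤ 27)

theorem affinelyEquivalent_mu4_of_sq {q : Conf 4 ℂ} (h0 : q 0 = 1) (h1 : q 1 = -1)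
    (h3 : q 3 = -q 2) (ht : q 2 ^ 2 = -1) : q.AffinelyEquivalent mu4 := by
  have h2 : q 2 = Complex.I ∨ q 2 = -Complex.I :=
    sq_eq_sq_iff_eq_or_eq_neg.1 (ht.trans Complex.I_sq.symm)
  rcases h2 with h2 | h2
  · refine affinelyEquivalent_of_image ![0, 2, 1, 3] (by decide) one_ne_zero (b := 0) fun i => ?_
    fin_cases i <;> simp [mu4_apply, h0, h1, h2, h3]
  · refine affinelyEquivalent_of_image ![0, 3, 1, 2] (by decide) one_ne_zero (b := 0) fun i => ?_
    fin_cases i <;> simp [mu4_apply, h0, h1, h2, h3]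

theorem encard_le_or_affinelyEquivalent_mu4 (q : Conf 4 ℂ) :
    (q.polyEndDeg 2).encard ≤ 27 ∨ q.AffinelyEquivalent mu4 := by
  by_cases hq : q.IsParallelogram
  · obtain ⟨r, hr, h0, h1, h3⟩ := hq.exists_affinelyEquivalent
    by_cases ht : r 2 ^ 2 = -1
    · exact Or.inr (affinelyEquivalent_equivalence.trans hr
        (affinelyEquivalent_mu4_of_sq h0 h1 h3 ht))
    · exact Or.inl (hr.encard_eq.trans_le (encard_parallelogram_le h0 h1 h3 ht))
  · exact Or.inl (encard_le_of_not_isParallelogram q hq)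

end Conf

theorem proposition4p1 :
    IsGreatest (Set.range fun q : Conf 4 ℂ => (q.polyEndDeg 2).encard) 28 ∧
      ∀ q : Conf 4 ℂ, (q.polyEndDeg 2).encard = 28 ↔ q.AffinelyEquivalent Conf.mu4 := by
  have hlt : (27 : ℕ∞) < 28 := by exact_mod_cast (by norm_num : 27 < 28)
  refine ⟨⟨⟨Conf.mu4, Conf.encard_mu4⟩, ?_⟩, fun q => ⟨fun h => ?_, fun h => ?_⟩⟩
  · rintro _ ⟨q, rfl⟩
    rcases q.encard_le_or_affinelyEquivalent_mu4 with h | h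
    · exact h.trans hlt.le
    · exact (h.encard_eq.trans Conf.encard_mu4).le
  · rcases q.encard_le_or_affinelyEquivalent_mu4 with h' | h'
    · exact absurd (h ▸ h') hlt.not_ge
    · exact h'
  · exact h.encard_eq.trans Conf.encard_mu4
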